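/- The discrete half-line is the infinite path with nodes $0,1,2,\dots$. The root $0$ has degree $1$ and its only port is $0$, leading to node $1$; every node $j>0$ has degree $2$, its port $0$ leading to $j+1$ and its port $1$ leading to $j-1$. A finite team of automata consists of a finite set $\mathcal A$ of agents, a finite set $Q$ of states with a distinguished state $STOP$, a transition function $\delta:Q\times I\to Q$ and an output function $\lambda:Q\times I\to\{*,0,1\}$ common to all agents, where $I=\{1,2\}\times 2^{Q}$, and pairwise different starting states $S_a\in Q$ of the agents $a\in\mathcal A$; the output at the root is never the non-existing port $1$. The agents move on the half-line in synchronous rounds. The input of an agent at a node $v$ is $(d,Z)$, where $d$ is the degree of $v$ and $Z$ is the set of current states of all other agents at $v$. In a round, simultaneously, every agent in a state $S\neq STOP$ with input $(d,Z)$ goes to state $\delta(S,(d,Z))$, and stays at $v$ if $\lambda(S,(d,Z))=*$, or else moves through the port $\lambda(S,(d,Z))$. An agent in state $STOP$ has terminated: it neither moves nor changes its state. For $k\ge 1$, the team computes a function $f:\mathbb N^k\to\mathbb N$ if there is a partition of $\mathcal A$ into $k$ non-empty groups $\mathcal A_1,\dots,\mathcal A_k$ such that, for all arguments $(x_1,\dots,x_k)\in\mathbb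 N^k$, the following holds. If initially every agent $a$ is in state $S_a$, and the agents of $\mathcal A_i$ are at node $x_i$ for $1\le i\le k$, then there is a round in which all agents, none of them stopped yet, are gathered at node $f(x_1,\dots,x_k)$, and in the next round all of them are at this node in state $STOP$. Theorem. For every $k\ge 1$ and every primitive recursive function $f:\mathbb N^k\to\mathbb N$, there is a finite team of automata that computes $f$. -/

import Mathlib

/-!
Teams of deterministic finite (Mealy) automata on the discrete half-line.

The half-line is the infinite path with nodes `0, 1, 2, …`; node `0` is the root. It has degree `1`
and its only port is `0`. Every node `j > 0` has degree `2`: port `0` leads to `j + 1` (right) and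
port `1` leads to `j - 1` (left).
-/

namespace HalfLine

/-- The degrees that occur in the half-line. -/
inductive Degree where
  | one
  | two

/-- The output alphabet: `idle` is the symbol `*`, `port0` goes right, `port1` goes left. -/
inductive Output where
  | idle
  | port0
  | port1

/-- The degree of a node: the root has degree `1`, all other nodes have degree `2`. -/
def degree : ℕ → Degree
  | 0 => Degree.one
  | _ + 1 => Degree.two

/-- The node at which an agent that is at node `j` arrives with a given output. (The root has no
port `1`; the value there is irrelevant, since a team never outputs `port1` at the root.) -/
def move (j : ℕ) : Output → ℕ
  | Output.idle => j
  | Output.port0 => j + 1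
  | Output.port1 => j - 1

/-- A team of Mealy automata, with agents indexed by `A` and common state set `Q`. All agents have
the same transition function and the same output function, whose inputs are a degree and the set of
states of the other agents at the same node; they differ in their starting states only. -/
structure Team (A Q : Type) where
  /-- The special state `STOP`. -/
  haltState : Q
  /-- The state transition function. -/
  trans : Q → Degree × Set Q → Q
  /-- The output function. -/
  out : Q → Degree × Set Q → Output
  /-- Agents only take existing ports: there is no port `1` at the root. -/
  out_root : ∀ (q : Q) (Z : Set Q), out q (Degree.one, Z) ≠ Output.port1
  /-- The starting state of each agent. -/
  start : A → Q
  /-- Different agents have different starting states. -/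
  start_injective : Function.Injective start

/-- A configuration: the current node and the current state of each agent. -/
structure Config (A Q : Type) where
  pos : A → ℕ
  state : A → Q

namespace Config

variable {A Q : Type}

/-- The set of states of all agents other than `a` that are at the same node as `a`. -/
def seen (c : Config A Q) (a : A) : Set Q :=
  {q | ∃ b, b ≠ a ∧ c.pos b = c.pos a ∧ c.state b = q}

/-- The input of agent `a`: the degree of its node and the set of states of the other agents
at this node. -/
def input (c : Config A Q) (a : A) : Degree × Set Q :=
  (degree (c.pos a), c.seen a)

end Config

namespace Team

variable {A Q : Type}

open Classical in
/-- One synchronous round. An agent in state `STOP` has terminated: it keeps its node and state. -/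
noncomputable def step (T : Team A Q) (c : Config A Q) : Config A Q where
  pos a := if c.state a = T.haltState then c.pos a else move (c.pos a) (T.out (c.state a) (c.input a))
  state a := if c.state a = T.haltState then T.haltState else T.trans (c.state a) (c.input a)

/-- The initial configuration in which the agents of the `i`-th group are at node `x i`. -/
def init {k : ℕ} (T : Team A Q) (group : A → Fin k) (x : List.Vector ℕ k) : Config A Q where
  pos a := x.get (group a)
  state := T.start

/-- The configuration after `t` rounds. -/
noncomputable def run {k : ℕ} (T : Team A Q) (group : A → Fin k) (x : List.Vector ℕ k) (t : ℕ) :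
    Config A Q :=
  T.step^[t] (T.init group x)

/-- The team computes `f`: its agents can be partitioned into `k` non-empty groups so that, for all
arguments `x`, when the agents of the `i`-th group start at node `x i`, there is a round in which
all agents, none of which has stopped yet, are gathered at the node `f x`, and then all of them
transit to `STOP` at this node. -/
def Computes {k : ℕ} (T : Team A Q) (f : List.Vector ℕ k → ℕ) : Prop :=
  ∃ group : A → Fin k, Function.Surjective group ∧
    ∀ x : List.Vector ℕ k, ∃ t : ℕ,
      (∀ a, (T.run group x t).pos a = f x ∧ (T.run group x t).state a ≠ T.haltState) ∧
      (∀ a, (T.run group x (t + 1)).pos a = f x ∧ (T.run group x (t + 1)).state a = T.haltState)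

end Team

end HalfLine

/-! A natural number is stored as the position of an agent. Each register of a counter program is
represented by a marker agent standing at the node equal to its contents; one further agent, the
head, carries the finite control. To execute an instruction the head walks to the root, then
searches to the right for the marker concerned. When they meet, the degree of the node tells whether
the register is zero, the presence of a second marker tells whether two registers are equal, and the
marker, seeing the head's state, steps right or left (`step_found`). Increment, decrement, zero test
and equality test are thus available (`leads_of_reaches`).

These suffice for primitive recursion (`exists_evaluates`), and structured programs need only
finitely many control states (`finite_conts`, `reaches_of_exec`).

To finish, the head sweeps right from the root and takes along every marker it meets, so that all
agents gather at the largest register value (`leads_gathered`). Hence every register but the result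
is cleared beforehand. The registers that are not arguments start with arbitrary contents, which is
why the programs must be correct from every initial memory. -/

namespace HalfLine

/-! ### A register language computing all primitive recursive functions -/

/-- Programs over registers indexed by `ℕ`; `loop a b p` repeats `p` while the contents of the
registers `a` and `b` differ. -/
inductive Prog where
  | zero (b : ℕ)
  | inc (b : ℕ)
  | seq (p q : Prog)
  | loop (a b : ℕ) (p : Prog)

/-- Big-step semantics of programs. -/
inductive Exec : Prog → (ℕ → ℕ) → (ℕ → ℕ) → Prop
  | zero (b : ℕ) (σ : ℕ → ℕ) : Exec (.zero b) σ (Function.update σ b 0)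
  | inc (b : ℕ) (σ : ℕ → ℕ) : Exec (.inc b) σ (Function.update σ b (σ b + 1))
  | seq {p q : Prog} {σ τ υ : ℕ → ℕ} : Exec p σ τ → Exec q τ υ → Exec (.seq p q) σ υ
  | loop_eq {a b : ℕ} {p : Prog} {σ : ℕ → ℕ} : σ a = σ b → Exec (.loop a b p) σ σ
  | loop_ne {a b : ℕ} {p : Prog} {σ τ υ : ℕ → ℕ} : σ a ≠ σ b → Exec p σ τ →
      Exec (.loop a b p) τ υ → Exec (.loop a b p) σ υ

namespace Prog

/-- Copy register `a` to register `b`. -/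
def copy (a b : ℕ) : Prog := .seq (.zero b) (.loop b a (.inc b))

theorem exec_loop_inc {a b : ℕ} (hab : a ≠ b) (d : ℕ) :
    ∀ σ : ℕ → ℕ, σ b + d = σ a → Exec (.loop b a (.inc b)) σ (Function.update σ b (σ a)) := by
  induction d with
  | zero =>
    intro σ h
    have h' : σ b = σ a := h
    have : Function.update σ b (σ a) = σ := by rw [← h', Function.update_eq_self]
    rw [this]
    exact .loop_eq h'
  | succ d ih =>
    intro σ h
    refine .loop_ne (by omega) (.inc b σ) ?_
    have := ih (Function.update σ b (σ b + 1)) (by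
      rw [Function.update_self, Function.update_of_ne hab]; omega)
    rwa [Function.update_of_ne hab, Function.update_idem] at this

theorem exec_copy {a b : ℕ} (hab : a ≠ b) (σ : ℕ → ℕ) :
    Exec (copy a b) σ (Function.update σ b (σ a)) := by
  refine .seq (.zero b σ) ?_
  have := exec_loop_inc hab (σ a) (Function.update σ b 0) (by
    rw [Function.update_self, Function.update_of_ne hab, zero_add])
  rwa [Function.update_of_ne hab, Function.update_idem] at this

/-- `p` computes `f` from the registers `src` into the register `dst`, without changing the other
registers below `s`. -/
def Evaluates {n : ℕ} (p : Prog) (f : List.Vector ℕ n → ℕ) (src : Fin n → ℕ) (dst s : ℕ) : Prop :=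
  ∀ σ : ℕ → ℕ, ∃ τ, Exec p σ τ ∧ τ dst = f (List.Vector.ofFn fun i => σ (src i)) ∧
    ∀ j < s, j ≠ dst → τ j = σ j

theorem exists_evaluates_family {n m : ℕ} (g : Fin n → List.Vector ℕ m → ℕ) (src : Fin m → ℕ)
    (s : ℕ) (hs : ∀ i, src i < s)
    (hg : ∀ i dst s', (∀ i, src i < s') → dst < s' → (∀ i, src i ≠ dst) →
      ∃ p : Prog, p.Evaluates (g i) src dst s') :
    ∀ t ≤ n, ∃ p : Prog, ∀ σ : ℕ → ℕ, ∃ τ, Exec p σ τ ∧ (∀ j < s, τ j = σ j) ∧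
      ∀ i : Fin n, i.1 < t → τ (s + i.1) = g i (List.Vector.ofFn fun i => σ (src i)) := by
  intro t
  induction t with
  | zero =>
    intro _
    -- There is no empty program; clearing the unprotected register `s` serves as one.
    refine ⟨.zero s, fun σ => ⟨_, .zero s σ, fun j hj => ?_, fun i hi => absurd hi (by omega)⟩⟩
    exact Function.update_of_ne (by omega) _ _
  | succ t ih =>
    intro ht
    obtain ⟨p, hp⟩ := ih (by omega)
    obtain ⟨q, hq⟩ := hg ⟨t, ht⟩ (s + t) (s + n) (fun i => by have := hs i; omega) (by omega)
      (fun i => by have := hs i; omega)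
    refine ⟨.seq p q, fun σ => ?_⟩
    obtain ⟨τ, h1, h2, h3⟩ := hp σ
    obtain ⟨υ, k1, k2, k3⟩ := hq τ
    have hsrc : (fun i => τ (src i)) = fun i => σ (src i) := funext fun i => h2 _ (hs i)
    refine ⟨υ, .seq h1 k1, fun j hj => ?_, fun i hi => ?_⟩
    · rw [k3 j (by omega) (by omega), h2 j hj]
    · by_cases h : i.1 = t
      · obtain rfl : i = ⟨t, ht⟩ := Fin.ext h
        rw [k2, hsrc]
      · rw [k3 _ (by have := i.2; omega) (by omega), h3 i (by omega)]

/-- Registers from `s` upwards are scratch space. Quantifying over `src`, `dst` and `s` lets the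
induction relocate subprograms: composition stores the inner values at `s + i`, above all protected
registers. -/
theorem exists_evaluates {n : ℕ} {f : List.Vector ℕ n → ℕ} (hf : Nat.Primrec' f) :
    ∀ (src : Fin n → ℕ) (dst s : ℕ), (∀ i, src i < s) → dst < s → (∀ i, src i ≠ dst) →
      ∃ p : Prog, p.Evaluates f src dst s := by
  induction hf with
  | zero =>
    intro src dst s _ _ _
    exact ⟨.zero dst, fun σ => ⟨_, .zero dst σ, by simp, fun j _ hj => by simp [hj]⟩⟩
  | succ =>
    intro src dst s _ _ hne
    refine ⟨.seq (copy (src 0) dst) (.inc dst), fun σ =>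
      ⟨_, .seq (exec_copy (hne 0) σ) (.inc dst _), ?_, fun j _ hj => by simp [hj]⟩⟩
    simp [List.Vector.ofFn]
  | get i =>
    intro src dst s _ _ hne
    exact ⟨copy (src i) dst, fun σ =>
      ⟨_, exec_copy (hne i) σ, by simp, fun j _ hj => by simp [hj]⟩⟩
  | @comp m n f g _ _ ihf ihg =>
    intro src dst s hs hd hne
    obtain ⟨p, hp⟩ := exists_evaluates_family g src s hs (fun i dst s' => ihg i src dst s') n le_rfl
    obtain ⟨q, hq⟩ := ihf (fun i => s + i.1) dst (s + n) (fun i => by have := i.2; omega)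
      (by omega) (fun i => by omega)
    refine ⟨.seq p q, fun σ => ?_⟩
    obtain ⟨τ, h1, h2, h3⟩ := hp σ
    obtain ⟨υ, k1, k2, k3⟩ := hq τ
    refine ⟨υ, .seq h1 k1, ?_, fun j hj hjd => by rw [k3 j (by omega) hjd, h2 j hj]⟩
    rw [k2]
    congr 2
    exact funext fun i => h3 i i.2
  | @prec n f g _ _ ihf ihg =>
    intro src dst s hs hd hne
    obtain ⟨p, hp⟩ := ihf (fun i => src i.succ) dst (s + 2) (fun i => by have := hs i.succ; omega)
      (by omega) (fun i => hne _)
    obtain ⟨q, hq⟩ := ihg (Fin.cons s (Fin.cons dst fun i => src i.succ)) (s + 1) (s + 2)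
      (fun i => by
        refine Fin.cases ?_ (fun i => Fin.cases ?_ (fun i => ?_) i) i
        · simp
        · simp; omega
        · have := hs i.succ; simp; omega)
      (by omega)
      (fun i => by
        refine Fin.cases ?_ (fun i => Fin.cases ?_ (fun i => ?_) i) i
        · simp
        · simp; omega
        · have := hs i.succ; simp; omega)
    -- Register `s` counts the iterations and `dst` holds the value so far. Since a target must
    -- differ from its sources, `g` writes to `s + 1` and the result is copied back.
    let body : Prog := .seq (.seq q (copy (s + 1) dst)) (.inc s)
    let F : List.Vector ℕ n → ℕ → ℕ := fun w y => y.rec (f w) fun y IH => g (y ::ᵥ IH ::ᵥ w)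
    have key : ∀ d : ℕ, ∀ σ : ℕ → ℕ, σ s + d = σ (src 0) →
        σ dst = F (List.Vector.ofFn fun i => σ (src i.succ)) (σ s) →
        ∃ τ, Exec (.loop s (src 0) body) σ τ ∧
          τ dst = F (List.Vector.ofFn fun i => σ (src i.succ)) (σ (src 0)) ∧
          ∀ j < s, j ≠ dst → τ j = σ j := by
      intro d
      induction d with
      | zero =>
        intro σ h1 h2
        have h1 : σ s = σ (src 0) := h1
        exact ⟨σ, .loop_eq h1, by rw [h2, h1], fun _ _ _ => rfl⟩
      | succ d ih =>
        intro σ h1 h2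
        obtain ⟨τ, e1, e2, e3⟩ := hq σ
        let υ := Function.update τ dst (τ (s + 1))
        let ω := Function.update υ s (υ s + 1)
        have hb : Exec body σ ω :=
          .seq (.seq e1 (exec_copy (by omega) τ)) (.inc s υ)
        have hωs : ω s = σ s + 1 := by
          simp only [ω, υ, Function.update_self]
          rw [Function.update_of_ne (by omega), e3 s (by omega) (by omega)]
        have hωj : ∀ j < s, j ≠ dst → ω j = σ j := fun j hj hjd => by
          simp only [ω, υ]
          rw [Function.update_of_ne (by omega), Function.update_of_ne hjd,
            e3 j (by omega) (by omega)]
        have hωd : ω dst = τ (s + 1) := by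
          simp only [ω, υ]
          rw [Function.update_of_ne (by omega), Function.update_self]
        have hsrc : (fun i : Fin n => ω (src i.succ)) = fun i => σ (src i.succ) :=
          funext fun i => hωj _ (hs _) (hne _)
        obtain ⟨ρ, r1, r2, r3⟩ := ih ω (by rw [hωs, hωj _ (hs 0) (hne 0)]; omega) (by
          rw [hωd, e2, hsrc, hωs]
          simp only [F]
          congr 1
          simp only [List.Vector.ofFn, Fin.cons_zero, Fin.cons_succ]
          rw [h2])
        refine ⟨ρ, .loop_ne (by omega) hb r1, ?_, fun j hj hjd => ?_⟩
        · rw [r2, hsrc, hωj _ (hs 0) (hne 0)]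
        · rw [r3 j hj hjd, hωj j hj hjd]
    refine ⟨.seq (.seq p (.zero s)) (.loop s (src 0) body), fun σ => ?_⟩
    obtain ⟨τ, h1, h2, h3⟩ := hp σ
    have hτj : ∀ j < s, j ≠ dst → Function.update τ s 0 j = σ j := fun j hj hjd => by
      rw [Function.update_of_ne (by omega), h3 j (by omega) hjd]
    have hsrc : (fun i : Fin n => Function.update τ s 0 (src i.succ)) = fun i => σ (src i.succ) :=
      funext fun i => hτj _ (hs _) (hne _)
    obtain ⟨ρ, r1, r2, r3⟩ := key (σ (src 0)) (Function.update τ s 0)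
      (by rw [hτj _ (hs 0) (hne 0), Function.update_self, zero_add])
      (by
        rw [hsrc, Function.update_of_ne (by omega), Function.update_self, h2]
        rfl)
    refine ⟨ρ, .seq (.seq h1 (.zero s τ)) r1, ?_, fun j hj hjd => by rw [r3 j hj hjd, hτj j hj hjd]⟩
    rw [r2, hsrc, hτj _ (hs 0) (hne 0)]
    simp only [F, List.Vector.ofFn, List.Vector.head_cons, List.Vector.tail_cons]

/-! ### Register bounds and final clean-up -/

/-- All registers of a program are below its bound. -/
def bound : Prog → ℕ
  | zero b => b + 1
  | inc b => b + 1
  | seq p q => max p.bound q.bound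
  | loop a b p => max (max (a + 1) (b + 1)) p.bound

/-- Run `p`, then clear all registers below `t` except `d`. -/
def clearing (p : Prog) (d : ℕ) : ℕ → Prog
  | 0 => p
  | t + 1 => if t = d then clearing p d t else .seq (clearing p d t) (.zero t)

theorem bound_clearing (p : Prog) (d t m : ℕ) (hp : p.bound ≤ m) (ht : t ≤ m) :
    (p.clearing d t).bound ≤ m := by
  induction t with
  | zero => exact hp
  | succ t ih =>
    have := ih (by omega)
    rw [clearing]
    split
    · exact this
    · simp only [bound]; omega

theorem exec_clearing {p : Prog} {σ τ : ℕ → ℕ} (h : Exec p σ τ) (d t : ℕ) :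
    ∃ υ, Exec (p.clearing d t) σ υ ∧ υ d = τ d ∧ ∀ j < t, j ≠ d → υ j = 0 := by
  induction t with
  | zero => exact ⟨τ, h, rfl, fun j hj => absurd hj (by omega)⟩
  | succ t ih =>
    obtain ⟨υ, h1, h2, h3⟩ := ih
    by_cases htd : t = d
    · refine ⟨υ, by rwa [clearing, if_pos htd], h2, fun j hj hjd => h3 j (by omega) hjd⟩
    · refine ⟨Function.update υ t 0, ?_, ?_, fun j hj hjd => ?_⟩
      · rw [clearing, if_neg htd]
        exact .seq h1 (.zero t υ)
      · rw [Function.update_of_ne (Ne.symm htd), h2]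
      · by_cases hjt : j = t
        · rw [hjt, Function.update_self]
        · rw [Function.update_of_ne hjt, h3 j (by omega) hjd]

end Prog

/-! ### Register machines -/

/-- A register machine: in a non-halting state `s` it inspects the register `reg s`, changes it
according to `out`, and continues depending on whether the register was zero and whether it was
equal to the register `other s`. -/
structure Machine (R S : Type) where
  halt : S
  reg : S → R
  other : S → R
  out : S → Degree → Output
  next : S → Degree → Bool → S

namespace Machine

variable {R S : Type} [DecidableEq R]

/-- One step of a machine. -/
def step (M : Machine R S) (c : S × (R → ℕ)) : S × (R → ℕ) :=
  (M.next c.1 (degree (c.2 (M.reg c.1))) (decide (c.2 (M.other c.1) = c.2 (M.reg c.1))),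
    Function.update c.2 (M.reg c.1) (move (c.2 (M.reg c.1)) (M.out c.1 (degree (c.2 (M.reg c.1))))))

/-- Reachability through steps from non-halting states. -/
def Reaches (M : Machine R S) : S × (R → ℕ) → S × (R → ℕ) → Prop :=
  Relation.ReflTransGen fun c c' => c.1 ≠ M.halt ∧ M.step c = c'

end Machine

/-! ### Programs as machines: the control states are continuations -/

namespace Prog

/-- The continuations that occur while `p` is run with continuation `k`, except `k` itself. -/
def conts : Prog → List Prog → Set (List Prog)
  | zero b, k => {zero b :: k}
  | inc b, k => {inc b :: k}
  | seq p q, k => insert (seq p q :: k) (conts p (q :: k) ∪ conts q k)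
  | loop a b p, k => insert (loop a b p :: k) (conts p (loop a b p :: k))

/-- A loop body returns to the continuation that starts with the loop itself, so iterating does not
deepen the stack; the continuations are determined by the syntax alone. -/
theorem finite_conts (p : Prog) : ∀ k, (conts p k).Finite := by
  induction p with
  | zero b => exact fun k => Set.finite_singleton _
  | inc b => exact fun k => Set.finite_singleton _
  | seq p q hp hq => exact fun k => ((hp _).union (hq _)).insert _
  | loop a b p hp => exact fun k => (hp _).insert _

theorem cons_mem_conts (p : Prog) (k : List Prog) : p :: k ∈ conts p k := by
  cases p <;> simp [conts]

/-- The register inspected first by a continuation. -/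
def headReg : List Prog → ℕ
  | zero b :: _ => b
  | inc b :: _ => b
  | loop a _ _ :: _ => a
  | _ => 0

/-- The register that is compared with `headReg`. -/
def headOther : List Prog → ℕ
  | loop _ b _ :: _ => b
  | _ => 0

/-- How the first register of a continuation changes. -/
def headOut : List Prog → Degree → Output
  | zero _ :: _, .two => .port1
  | inc _ :: _, _ => .port0
  | _, _ => .idle

/-- The continuation after one step. -/
def nextCont : List Prog → Degree → Bool → List Prog
  | zero _ :: k, .one, _ => k
  | zero b :: k, .two, _ => zero b :: k
  | inc _ :: k, _, _ => k
  | seq p q :: k, _, _ => p :: q :: k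
  | loop _ _ _ :: k, _, true => k
  | loop a b p :: k, _, false => p :: loop a b p :: k
  | [], _, _ => []

theorem nextCont_mem (p : Prog) : ∀ k, ∀ l ∈ conts p k, ∀ d e,
    nextCont l d e = k ∨ nextCont l d e ∈ conts p k := by
  induction p with
  | zero b => rintro k l rfl d e; cases d <;> simp [nextCont, conts]
  | inc b => rintro k l rfl d e; simp [nextCont]
  | seq p q ihp ihq =>
    rintro k l (rfl | hl | hl) d e
    · exact .inr (.inr (.inl (cons_mem_conts _ _)))
    · rcases ihp _ l hl d e with h | h
      · exact .inr (.inr (.inr (h ▸ cons_mem_conts _ _)))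
      · exact .inr (.inr (.inl h))
    · rcases ihq _ l hl d e with h | h
      · exact .inl h
      · exact .inr (.inr (.inr h))
  | loop a b p ih =>
    rintro k l (rfl | hl) d e
    · cases e
      · exact .inr (.inr (cons_mem_conts _ _))
      · exact .inl rfl
    · rcases ih _ l hl d e with h | h
      · exact .inr (.inl h)
      · exact .inr (.inr h)

/-- The control states of the machine running `p`. -/
def Control (p : Prog) : Type := {l : List Prog // l ∈ insert [] (conts p [])}

theorem finite_control (p : Prog) : Finite (Control p) :=
  ((finite_conts p []).insert []).to_subtype

/-- The machine running `p` on `m` registers. -/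
def machine (p : Prog) (m : ℕ) [NeZero m] : Machine (Fin m) (Control p) where
  halt := ⟨[], .inl rfl⟩
  -- Reduction modulo `m` has no effect on registers below `m`. The default register `0` is only a
  -- dummy: where `headReg` defaults to it the output is idle, and where `headOther` does,
  -- `nextCont` ignores the comparison.
  reg s := Fin.ofNat m (headReg s.1)
  other s := Fin.ofNat m (headOther s.1)
  out s := headOut s.1
  next s d e := ⟨nextCont s.1 d e, by
    rcases s.2 with h | h
    · exact .inl (by rw [h]; rfl)
    · exact nextCont_mem p [] s.1 h d e⟩

/-! ### Simulation of program executions by the machine -/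

/-- The restriction of a memory to the first `m` registers. -/
def restrict (m : ℕ) (σ : ℕ → ℕ) : Fin m → ℕ := fun i => σ i

theorem restrict_ofNat {m : ℕ} [NeZero m] {b : ℕ} (hb : b < m) (σ : ℕ → ℕ) :
    restrict m σ (Fin.ofNat m b) = σ b := by
  simp [restrict, Nat.mod_eq_of_lt hb]

theorem update_restrict {m : ℕ} [NeZero m] {b : ℕ} (hb : b < m) (σ : ℕ → ℕ) (v : ℕ) :
    Function.update (restrict m σ) (Fin.ofNat m b) v = restrict m (Function.update σ b v) := by
  funext i
  have : i = Fin.ofNat m b ↔ (i : ℕ) = b := by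
    rw [Fin.ext_iff, Fin.val_ofNat, Nat.mod_eq_of_lt hb]
  simp only [restrict, Function.update_apply, this]

theorem step_machine {p : Prog} {m : ℕ} [NeZero m] (l : List Prog) (hl : l ∈ insert [] (conts p []))
    (hr : headReg l < m) (ho : headOther l < m) (σ : ℕ → ℕ) :
    ∃ h, (p.machine m).step (⟨l, hl⟩, restrict m σ) =
      (⟨nextCont l (degree (σ (headReg l))) (decide (σ (headOther l) = σ (headReg l))), h⟩,
        restrict m (Function.update σ (headReg l)
          (move (σ (headReg l)) (headOut l (degree (σ (headReg l))))))) := by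
  have h1 := restrict_ofNat hr σ
  have h2 := restrict_ofNat ho σ
  have h := ((p.machine m).step (⟨l, hl⟩, restrict m σ)).1.2
  simp only [Machine.step, machine, h1, h2, update_restrict hr] at h ⊢
  exact ⟨h, trivial⟩

theorem reaches_of_step {p : Prog} {m : ℕ} [NeZero m] {q : Prog} {l l' : List Prog}
    {σ σ' : ℕ → ℕ} (hl : q :: l ∈ insert [] (conts p []))
    (hr : headReg (q :: l) < m) (ho : headOther (q :: l) < m)
    (hn : nextCont (q :: l) (degree (σ (headReg (q :: l))))
      (decide (σ (headOther (q :: l)) = σ (headReg (q :: l)))) = l')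
    (hσ : Function.update σ (headReg (q :: l)) (move (σ (headReg (q :: l)))
      (headOut (q :: l) (degree (σ (headReg (q :: l)))))) = σ') :
    ∃ h', (p.machine m).Reaches (⟨q :: l, hl⟩, restrict m σ) (⟨l', h'⟩, restrict m σ') := by
  obtain ⟨h, e⟩ := step_machine (q :: l) hl hr ho σ
  subst hn hσ
  refine ⟨h, .single ⟨fun h => ?_, e⟩⟩
  exact List.cons_ne_nil _ _ (congrArg Subtype.val h)

/-- Clearing takes many machine steps: the instruction stays on top of the stack, decrementing until
the degree reveals the root. -/
theorem reaches_zero {p : Prog} {m : ℕ} [NeZero m] {b : ℕ} (hb : b < m) {k : List Prog}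
    (hl : zero b :: k ∈ insert [] (conts p [])) (v : ℕ) : ∀ σ : ℕ → ℕ, σ b = v →
    ∃ h', (p.machine m).Reaches (⟨zero b :: k, hl⟩, restrict m σ)
      (⟨k, h'⟩, restrict m (Function.update σ b 0)) := by
  induction v with
  | zero =>
    intro σ h
    refine reaches_of_step hl hb (NeZero.pos m) ?_ ?_
    · simp [headReg, h, degree, nextCont]
    · simp [headReg, h, degree, headOut, move]
  | succ v ih =>
    intro σ h
    obtain ⟨h1, e1⟩ := reaches_of_step (σ := σ) (l' := zero b :: k)
      (σ' := Function.update σ b v) hl hb (NeZero.pos m)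
      (by simp [headReg, h, degree, nextCont])
      (by simp [headReg, h, degree, headOut, move])
    obtain ⟨h2, e2⟩ := ih (Function.update σ b v) (by simp)
    rw [Function.update_idem] at e2
    exact ⟨h2, e1.trans e2⟩

theorem reaches_of_exec {p : Prog} {m : ℕ} [NeZero m] {q : Prog} {σ τ : ℕ → ℕ} (hq : Exec q σ τ) :
    q.bound ≤ m → ∀ (k : List Prog) (hl : q :: k ∈ insert [] (conts p [])),
    ∃ h', (p.machine m).Reaches (⟨q :: k, hl⟩, restrict m σ) (⟨k, h'⟩, restrict m τ) := by
  induction hq with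
  | zero b σ => exact fun hb k hl => reaches_zero hb hl _ σ rfl
  | inc b σ => exact fun hb k hl => reaches_of_step hl hb (NeZero.pos m) rfl rfl
  | @seq q r σ τ υ _ _ ih1 ih2 =>
    intro hb k hl
    obtain ⟨h1, e1⟩ := reaches_of_step (m := m) (σ := σ) (l' := q :: r :: k) (σ' := σ) hl
      (NeZero.pos m) (NeZero.pos m) rfl (by simp [headOut, move])
    obtain ⟨h2, e2⟩ := ih1 (max_le_iff.1 hb).1 _ h1
    obtain ⟨h3, e3⟩ := ih2 (max_le_iff.1 hb).2 _ h2
    exact ⟨h3, (e1.trans e2).trans e3⟩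
  | @loop_eq a b q σ h =>
    intro hb k hl
    have hb' := max_le_iff.1 (max_le_iff.1 hb).1
    exact reaches_of_step hl hb'.1 hb'.2 (by simp [headReg, headOther, h, nextCont])
      (by simp [headOut, move])
  | @loop_ne a b q σ τ υ h _ _ ih1 ih2 =>
    intro hb k hl
    have hb' := max_le_iff.1 (max_le_iff.1 hb).1
    obtain ⟨h1, e1⟩ := reaches_of_step (m := m) (σ := σ) (l' := q :: loop a b q :: k) (σ' := σ) hl
      hb'.1 hb'.2 (by simp [headReg, headOther, Ne.symm h, nextCont]) (by simp [headOut, move])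
    obtain ⟨h2, e2⟩ := ih1 (max_le_iff.1 hb).2 _ h1
    obtain ⟨h3, e3⟩ := ih2 hb _ h2
    exact ⟨h3, (e1.trans e2).trans e3⟩

end Prog

/-! ### Machines as teams -/

/-- The states of the agents simulating a machine: `marker r` is the state of the agent whose
position is the content of the register `r`; the agent in the states `head s b` controls the others.
It is on its way to the root if `b = false`, and searches the half-line to the right if `b = true`.
-/
inductive TeamState (R S : Type) where
  | halted
  | marker (r : R)
  | head (s : S) (b : Bool)

namespace TeamState

theorem finite (R S : Type) [Finite R] [Finite S] : Finite (TeamState R S) := by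
  refine Finite.of_injective (β := Option (R ⊕ S × Bool))
    (fun q => match q with
      | halted => none
      | marker r => some (.inl r)
      | head s b => some (.inr (s, b))) ?_
  rintro (_ | r | ⟨s, b⟩) (_ | r' | ⟨s', b'⟩) h <;> simp_all

end TeamState

/-- Suppress moves to the left at the root. -/
def restrictPort : Degree → Output → Output
  | .one, .port1 => .idle
  | _, o => o

/-- Truncated subtraction already makes a left move at the root stationary. -/
theorem move_restrictPort (v : ℕ) (o : Output) : move v (restrictPort (degree v) o) = move v o := by
  cases v <;> cases o <;> rfl

namespace Machine

variable {R S : Type}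

open TeamState

open Classical in
/-- The transition function of the team simulating a machine. -/
noncomputable def teamTrans (M : Machine R S) : TeamState R S → Degree × Set (TeamState R S) →
    TeamState R S
  | halted, _ => halted
  | marker r, (_, Z) => if head M.halt true ∈ Z ∧ ∀ i, i ≠ r → marker i ∈ Z then halted else marker r
  | head s false, (.one, _) => head s true
  | head s false, (.two, _) => head s false
  | head s true, (d, Z) =>
    if s = M.halt then if ∀ i, marker i ∈ Z then halted else head s true
    else if marker (M.reg s) ∈ Z then head (M.next s d (decide (marker (M.other s) ∈ Z))) false
    else head s true

open Classical in
/-- The output function of the team simulating a machine. -/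
noncomputable def teamOut (M : Machine R S) : TeamState R S → Degree × Set (TeamState R S) → Output
  | halted, _ => .idle
  | marker r, (d, Z) =>
    if head M.halt true ∈ Z then if ∀ i, i ≠ r → marker i ∈ Z then .idle else .port0
    -- Rules must cover all sets `Z`, but only one head exists, so in actual configurations the
    -- chosen state is its true state.
    else if h : ∃ s, M.reg s = r ∧ head s true ∈ Z then restrictPort d (M.out h.choose d)
    else .idle
  | head _ false, (.one, _) => .idle
  | head _ false, (.two, _) => .port1
  | head s true, (_, Z) =>
    if s = M.halt then if ∀ i, marker i ∈ Z then .idle else .port0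
    else if marker (M.reg s) ∈ Z then .idle
    else .port0

/-- The team simulating a machine from its state `s`. The agent `none` is the head. -/
noncomputable def team (M : Machine R S) (s : S) : Team (Option R) (TeamState R S) where
  haltState := halted
  trans := M.teamTrans
  out := M.teamOut
  out_root q Z := by
    rcases q with _ | r | ⟨s, _ | _⟩ <;> simp only [teamOut]
    · simp
    · split_ifs
      · simp
      · simp
      · generalize M.out _ _ = o
        cases o <;> simp [restrictPort]
      · simp
    · simp
    · split_ifs <;> simp
  start a := a.elim (head s false) marker
  start_injective := by
    rintro (_ | r) (_ | r') h <;> simp_all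

/-- The configuration with head state `head s b` at node `v` and register contents `σ`. -/
def config (s : S) (b : Bool) (v : ℕ) (σ : R → ℕ) : Config (Option R) (TeamState R S) where
  pos a := a.elim v σ
  state a := a.elim (head s b) marker

theorem marker_mem_seen_none {s : S} {b : Bool} {v : ℕ} {σ : R → ℕ} {r : R} :
    marker r ∈ (config s b v σ).seen none ↔ σ r = v := by
  constructor
  · rintro ⟨_ | r', h1, h2, h3⟩
    · exact absurd rfl h1
    · obtain rfl : r' = r := by simpa [config] using h3
      exact h2
  · exact fun h => ⟨some r, by simp, h, rfl⟩

theorem head_mem_seen_some {s s' : S} {b b' : Bool} {v : ℕ} {σ : R → ℕ} {r : R} :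
    head s' b' ∈ (config s b v σ).seen (some r) ↔ v = σ r ∧ s' = s ∧ b' = b := by
  constructor
  · rintro ⟨_ | r', h1, h2, h3⟩
    · obtain ⟨rfl, rfl⟩ : s = s' ∧ b = b' := by simpa [config] using h3
      exact ⟨h2, rfl, rfl⟩
    · simp [config] at h3
  · rintro ⟨h, rfl, rfl⟩
    exact ⟨none, by simp, h, rfl⟩

theorem marker_mem_seen_some {s : S} {b : Bool} {v : ℕ} {σ : R → ℕ} {r i : R} :
    marker i ∈ (config s b v σ).seen (some r) ↔ i ≠ r ∧ σ i = σ r := by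
  constructor
  · rintro ⟨_ | r', h1, h2, h3⟩
    · simp [config] at h3
    · obtain rfl : r' = i := by simpa [config] using h3
      exact ⟨by simpa using h1, h2⟩
  · exact fun h => ⟨some i, by simpa using h.1, h.2, rfl⟩

/-! ### Single rounds of the team -/

variable (M : Machine R S) (s₀ : S)

theorem step_eq {c c' : Config (Option R) (TeamState R S)} (hc : ∀ a, c.state a ≠ halted)
    (hpos : ∀ a, move (c.pos a) (M.teamOut (c.state a) (c.input a)) = c'.pos a)
    (hstate : ∀ a, M.teamTrans (c.state a) (c.input a) = c'.state a) :
    (M.team s₀).step c = c' := by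
  obtain ⟨p, q⟩ := c'
  simp only [Team.step, Config.mk.injEq]
  exact ⟨funext fun a => (if_neg (hc a)).trans (hpos a),
    funext fun a => (if_neg (hc a)).trans (hstate a)⟩

theorem config_state_ne_halted (s : S) (b : Bool) (v : ℕ) (σ : R → ℕ) (a : Option R) :
    (config s b v σ).state a ≠ halted := by
  cases a <;> simp [config]

theorem step_home_succ (s : S) (v : ℕ) (σ : R → ℕ) :
    (M.team s₀).step (config s false (v + 1) σ) = config s false v σ := by
  refine step_eq M s₀ (config_state_ne_halted _ _ _ _) ?_ ?_
  · rintro (_ | r)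
    · rfl
    · change move (σ r) (M.teamOut (marker r) (_, _)) = σ r
      simp [teamOut, head_mem_seen_some, move]
  · rintro (_ | r)
    · rfl
    · change M.teamTrans (marker r) (_, _) = marker r
      simp [teamTrans, head_mem_seen_some]

theorem step_home_zero (s : S) (σ : R → ℕ) :
    (M.team s₀).step (config s false 0 σ) = config s true 0 σ := by
  refine step_eq M s₀ (config_state_ne_halted _ _ _ _) ?_ ?_
  · rintro (_ | r)
    · rfl
    · change move (σ r) (M.teamOut (marker r) (_, _)) = σ r
      simp [teamOut, head_mem_seen_some, move]
  · rintro (_ | r)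
    · rfl
    · change M.teamTrans (marker r) (_, _) = marker r
      simp [teamTrans, head_mem_seen_some]

/-- Markers of other registers passed on the way read from the head's state that they are not
addressed, and stay. -/
theorem step_search {s : S} (hs : s ≠ M.halt) {v : ℕ} {σ : R → ℕ} (hv : σ (M.reg s) ≠ v) :
    (M.team s₀).step (config s true v σ) = config s true (v + 1) σ := by
  refine step_eq M s₀ (config_state_ne_halted _ _ _ _) ?_ ?_
  · rintro (_ | r)
    · change move v (M.teamOut (head s true) (_, _)) = v + 1
      simp [teamOut, hs, marker_mem_seen_none, hv, move]
    · change move (σ r) (M.teamOut (marker r) (_, _)) = σ r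
      have h : ¬ ∃ s', M.reg s' = r ∧ head s' true ∈ (config s true v σ).seen (some r) := by
        rintro ⟨s', rfl, h⟩
        obtain ⟨h1, rfl, -⟩ := head_mem_seen_some.1 h
        exact hv h1.symm
      simp only [teamOut]
      rw [if_neg (by simp [head_mem_seen_some, Ne.symm hs]), dif_neg h]
      rfl
  · rintro (_ | r)
    · change M.teamTrans (head s true) (_, _) = head s true
      simp [teamTrans, hs, marker_mem_seen_none, hv]
    · change M.teamTrans (marker r) (_, _) = marker r
      simp [teamTrans, head_mem_seen_some, Ne.symm hs]

/-- Head and marker see each other in the same round, so both evaluate the same instruction at the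
same degree without exchanging messages. -/
theorem step_found [DecidableEq R] {s : S} (hs : s ≠ M.halt) (σ : R → ℕ) :
    (M.team s₀).step (config s true (σ (M.reg s)) σ) =
      config (M.step (s, σ)).1 false (σ (M.reg s)) (M.step (s, σ)).2 := by
  refine step_eq M s₀ (config_state_ne_halted _ _ _ _) ?_ ?_
  · rintro (_ | r)
    · change move _ (M.teamOut (head s true) (_, _)) = σ (M.reg s)
      simp [teamOut, hs, marker_mem_seen_none, move]
      rfl
    · change move (σ r) (M.teamOut (marker r) (_, _)) = (M.step (s, σ)).2 r
      simp only [teamOut]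
      rw [if_neg (by simp [head_mem_seen_some, Ne.symm hs])]
      by_cases hr : M.reg s = r
      · subst hr
        have h : ∃ s', M.reg s' = M.reg s ∧
            head s' true ∈ (config s true (σ (M.reg s)) σ).seen (some (M.reg s)) :=
          ⟨s, rfl, head_mem_seen_some.2 ⟨rfl, rfl, rfl⟩⟩
        have hc : h.choose = s := (head_mem_seen_some.1 h.choose_spec.2).2.1
        rw [dif_pos h, hc]
        exact (move_restrictPort _ _).trans (by simp [Machine.step]; rfl)
      · rw [dif_neg]
        · simp [Machine.step, Function.update_of_ne (Ne.symm hr), move]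
        · rintro ⟨s', rfl, h⟩
          obtain ⟨-, rfl, -⟩ := head_mem_seen_some.1 h
          exact hr rfl
  · rintro (_ | r)
    · change M.teamTrans (head s true) (_, _) = head _ false
      simp [teamTrans, hs, marker_mem_seen_none, Machine.step]
      rfl
    · change M.teamTrans (marker r) (_, _) = marker r
      simp [teamTrans, head_mem_seen_some, Ne.symm hs]

/-- A marker still elsewhere keeps everyone at `v` from halting; those at `v` move right together
with the head. -/
theorem step_sweep {v : ℕ} {σ : R → ℕ} (hσ : ∃ r, σ r ≠ v) :
    (M.team s₀).step (config M.halt true v σ) =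
      config M.halt true (v + 1) fun r => if σ r = v then v + 1 else σ r := by
  obtain ⟨r₀, h₀⟩ := hσ
  have key : ∀ r, σ r = v →
      ¬ ∀ i, i ≠ r → marker i ∈ (config M.halt true v σ).seen (some r) := by
    intro r hr h
    have := (marker_mem_seen_some.1 (h r₀ (by rintro rfl; exact h₀ hr))).2
    exact h₀ (this.trans hr)
  refine step_eq M s₀ (config_state_ne_halted _ _ _ _) ?_ ?_
  · rintro (_ | r)
    · change move v (M.teamOut (head M.halt true) (_, _)) = v + 1
      simp only [teamOut]
      rw [if_pos trivial, if_neg (fun h => h₀ (marker_mem_seen_none.1 (h r₀)))]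
      rfl
    · change move (σ r) (M.teamOut (marker r) (_, _)) = if σ r = v then v + 1 else σ r
      simp only [teamOut]
      by_cases hr : σ r = v
      · rw [if_pos (head_mem_seen_some.2 ⟨hr.symm, rfl, rfl⟩), if_neg (key r hr), if_pos hr, ← hr]
        rfl
      · rw [if_neg (fun h => hr (head_mem_seen_some.1 h).1.symm), if_neg hr, dif_neg]
        · rfl
        · rintro ⟨s', -, h⟩
          exact hr (head_mem_seen_some.1 h).1.symm
  · rintro (_ | r)
    · change M.teamTrans (head M.halt true) (_, _) = head M.halt true
      simp only [teamTrans]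
      rw [if_pos trivial, if_neg (fun h => h₀ (marker_mem_seen_none.1 (h r₀)))]
    · change M.teamTrans (marker r) (_, _) = marker r
      simp only [teamTrans]
      exact if_neg fun h => key r (head_mem_seen_some.1 h.1).1.symm h.2

theorem step_gathered (v : ℕ) :
    (M.team s₀).step (config M.halt true v fun _ => v) = ⟨fun _ => v, fun _ => halted⟩ := by
  refine step_eq M s₀ (config_state_ne_halted _ _ _ _) ?_ ?_
  · rintro (_ | r)
    · change move v (M.teamOut (head M.halt true) (_, _)) = v
      simp [teamOut, marker_mem_seen_none, move]
    · change move v (M.teamOut (marker r) (_, _)) = v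
      simp [teamOut, head_mem_seen_some, marker_mem_seen_some, move]
  · rintro (_ | r)
    · change M.teamTrans (head M.halt true) (_, _) = halted
      simp [teamTrans, marker_mem_seen_none]
    · change M.teamTrans (marker r) (_, _) = halted
      simp only [teamTrans]
      exact if_pos ⟨head_mem_seen_some.2 ⟨rfl, rfl, rfl⟩,
        fun i hi => marker_mem_seen_some.2 ⟨hi, rfl⟩⟩

/-! ### Runs of the team -/

/-- Reachability of configurations of the simulating team. -/
def Leads (c c' : Config (Option R) (TeamState R S)) : Prop :=
  ∃ t, (M.team s₀).step^[t] c = c'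

variable {M s₀}

theorem Leads.of_step {c c' : Config (Option R) (TeamState R S)} (h : (M.team s₀).step c = c') :
    Leads M s₀ c c' := ⟨1, h⟩

theorem Leads.trans {c c' c'' : Config (Option R) (TeamState R S)} (h : Leads M s₀ c c')
    (h' : Leads M s₀ c' c'') : Leads M s₀ c c'' := by
  obtain ⟨t, rfl⟩ := h
  obtain ⟨t', rfl⟩ := h'
  exact ⟨t' + t, Function.iterate_add_apply _ _ _ _⟩

theorem leads_home (s : S) (v : ℕ) (σ : R → ℕ) :
    Leads M s₀ (config s false v σ) (config s true 0 σ) := by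
  induction v with
  | zero => exact .of_step (step_home_zero M s₀ s σ)
  | succ v ih => exact .trans (.of_step (step_home_succ M s₀ s v σ)) ih

theorem leads_search {s : S} (hs : s ≠ M.halt) (σ : R → ℕ) (v : ℕ) (hv : v ≤ σ (M.reg s)) :
    Leads M s₀ (config s true 0 σ) (config s true v σ) := by
  induction v with
  | zero => exact ⟨0, rfl⟩
  | succ v ih => exact (ih (by omega)).trans (.of_step (step_search M s₀ hs (by omega)))

theorem leads_of_reaches [DecidableEq R] {c c' : S × (R → ℕ)} (h : M.Reaches c c') (v : ℕ) :
    ∃ v', Leads M s₀ (config c.1 false v c.2) (config c'.1 false v' c'.2) := by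
  induction h with
  | refl => exact ⟨v, 0, rfl⟩
  | @tail c' c'' _ h ih =>
    obtain ⟨v', h'⟩ := ih
    obtain ⟨hs, rfl⟩ := h
    exact ⟨_, ((h'.trans (leads_home _ _ _)).trans (leads_search hs _ _ le_rfl)).trans
      (.of_step (step_found M s₀ hs _))⟩

/-- The marker `r₀` waits at `y`, so the sweep cannot end earlier; no marker lies beyond `y`, so all
are collected there. Here `d` is the distance left to sweep. -/
theorem leads_gathered {y : ℕ} {r₀ : R} (d : ℕ) : ∀ (v : ℕ) (σ : R → ℕ), v + d = y →
    (∀ r, v ≤ σ r ∧ σ r ≤ y) → σ r₀ = y →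
    Leads M s₀ (config M.halt true v σ) (config M.halt true y fun _ => y) := by
  induction d with
  | zero =>
    rintro v σ rfl h _
    obtain rfl : σ = fun _ => v := funext fun r => le_antisymm (h r).2 (h r).1
    exact ⟨0, rfl⟩
  | succ d ih =>
    intro v σ hv h h₀
    refine .trans (.of_step (step_sweep M s₀ ⟨r₀, by omega⟩)) (ih (v + 1) _ (by omega) ?_ ?_)
    · intro r
      have := h r
      split_ifs <;> omega
    · rw [if_neg (by omega), h₀]

end Machine

end HalfLine

/-- Every primitive recursive function `f : ℕ^k → ℕ`, `k ≥ 1`, is computed by a finite team of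
deterministic finite automata on the half-line. -/
theorem mainTheorem1 {k : ℕ} (hk : 1 ≤ k) (f : List.Vector ℕ k → ℕ) (hf : Nat.Primrec' f) :
    ∃ (A Q : Type) (_ : Finite A) (_ : Finite Q) (T : HalfLine.Team A Q), T.Computes f := by
  open HalfLine Prog Machine in
  obtain ⟨p, hp⟩ := exists_evaluates hf (fun i => i) k (k + 1) (fun i => by omega) (by omega)
    (fun i => by omega)
  let m := max p.bound (k + 1)
  have hm : k < m := lt_of_lt_of_le (Nat.lt_succ_self k) (le_max_right _ _)
  have : NeZero m := ⟨by omega⟩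
  let P := p.clearing k m
  have hP : P.bound ≤ m := bound_clearing p k m m (le_max_left _ _) le_rfl
  have hmem : [P] ∈ insert [] (conts P []) := .inr (cons_mem_conts P [])
  let s₀ : Control P := ⟨[P], hmem⟩
  let M := P.machine m
  have := finite_control P
  refine ⟨Option (Fin m), TeamState (Fin m) (Control P), inferInstance, TeamState.finite _ _,
    M.team s₀, ?_⟩
  -- The head and the markers of all non-argument registers join the first group, so scratch
  -- registers initially contain the first argument.
  let g : ℕ → Fin k := fun j => if h : j < k then ⟨j, h⟩ else ⟨0, hk⟩
  refine ⟨fun a => a.elim ⟨0, hk⟩ fun j => g j, fun i => ⟨some ⟨i, by omega⟩, by simp [g]⟩,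
    fun x => ?_⟩
  let σ : ℕ → ℕ := fun j => x.get (g j)
  obtain ⟨τ, h1, h2, -⟩ := hp σ
  have hτ : τ k = f x := by
    rw [h2]
    congr 1
    ext i
    simp [σ, g]
  obtain ⟨υ, e1, e2, e3⟩ := exec_clearing h1 k m
  obtain ⟨_, r⟩ := reaches_of_exec (p := P) e1 hP [] hmem
  obtain ⟨v, hv⟩ := leads_of_reaches (s₀ := s₀) r (x.get ⟨0, hk⟩)
  have hg : Leads M s₀ (config M.halt true 0 (restrict m υ))
      (config M.halt true (f x) fun _ => f x) := by
    have hk' : restrict m υ ⟨k, hm⟩ = f x := e2.trans hτ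
    refine leads_gathered (f x) 0 _ (zero_add _) (fun r => ⟨Nat.zero_le _, ?_⟩) hk'
    -- After clearing, register `k` holds the maximum `f x`, all others being zero.
    by_cases hr : (r : ℕ) = k
    · simp only [restrict, hr, e2, hτ, le_refl]
    · simp only [restrict, e3 r r.2 hr, Nat.zero_le]
  obtain ⟨t, ht⟩ := (hv.trans (leads_home _ _ _)).trans hg
  have hinit : (M.team s₀).init (fun a => a.elim ⟨0, hk⟩ fun j => g j) x =
      config s₀ false (x.get ⟨0, hk⟩) (restrict m σ) := by
    simp only [Team.init, config, Config.mk.injEq]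
    refine ⟨funext fun a => ?_, rfl⟩
    cases a <;> rfl
  have hrun : (M.team s₀).run (fun a => a.elim ⟨0, hk⟩ fun j => g j) x t =
      config M.halt true (f x) fun _ => f x := by
    rw [Team.run, hinit]
    exact ht
  have hrun' : (M.team s₀).run (fun a => a.elim ⟨0, hk⟩ fun j => g j) x (t + 1) =
      ⟨fun _ => f x, fun _ => TeamState.halted⟩ := by
    rw [Team.run, Function.iterate_succ_apply', ← Team.run, hrun]
    exact step_gathered M s₀ (f x)
  refine ⟨t, fun a => ?_, fun a => ?_⟩
  · rw [hrun]
    exact ⟨by cases a <;> rfl, config_state_ne_halted _ _ _ _ a⟩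
  · rw [hrun']
    exact ⟨rfl, rfl⟩
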